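/- Let $a<b$ be real numbers and let $m\ge 1$ be an integer. For $n\ge 1$ let $t_i=a+i\,\frac{b-a}{n}$, $0\le i\le n$, be the $n+1$ equidistant nodes, and write $\|\cdot\|_\infty$ for the supremum norm on $[a,b]$. A clamped knot sequence (for $n+1$ B-splines of degree $m$) is a nondecreasing sequence $\tau_0\le\tau_1\le\dots\le\tau_{n+m+1}$ with $\tau_0=\dots=\tau_m=a$ and $\tau_{n+1}=\dots=\tau_{n+m+1}=b$. The B-splines $\mathcal B_{j,k}$ on it are given by the Cox–de Boor recursion: $\mathcal B_{j,0}$ is the indicator function of $[\tau_j,\tau_{j+1})$ (the last nonempty knot interval, ending at $b$, being taken closed), and for $k\ge1$ $$\mathcal B_{j,k}(t)=\frac{t-\tau_j}{\tau_{j+k}-\tau_j}\,\mathcal B_{j,k-1}(t)+\frac{\tau_{j+k+1}-t}{\tau_{j+k+1}-\tau_{j+1}}\,\mathcal B_{j+1,k-1}(t),$$ where a quotient with zero denominator counts as $0$. Let $S$ be the set of continuous functions on $[a,b]$ of the form $\sum_{j=0}^n c_j\mathcal B_{j,m}$ with $c_j\in\mathbb R$. The interpolation operator is well defined if for every $g\in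 C[a,b]$ there is exactly one $Ig\in S$ with $(Ig)(t_i)=g(t_i)$ for $0\le i\le n$. It is bounded if $$\|I\|:=\sup\Big\{\frac{\|Ig\|_\infty}{\|g\|_\infty}: g\in C[a,b],\ g\ne0\Big\}<\infty .$$ **Theorem 4.1.** 1. There is a constant $C_{m,a,b}>0$ depending only on $m,a,b$ such that for every $n\ge1$, every clamped knot sequence for which the interpolation operator $I$ is well defined and bounded, and every $f\in C^m[a,b]$, the B-spline interpolant $\mu=If$ of degree $m$ satisfies $$\|f-\mu\|_\infty\le(1+\|I\|)\,C_{m,a,b}\,n^{-m}\,\|f^{(m)}\|_\infty .$$ 2. For every $n\ge1$ and every $f\in C^2[a,b]$, the piecewise linear interpolant $p_1(t)=f(t_i)+\frac{f(t_{i+1})-f(t_i)}{t_{i+1}-t_i}(t-t_i)$ for $t\in[t_i,t_{i+1}]$, $0\le i<n$, satisfies $$\|f-p_1\|_\infty\le\frac{(b-a)^2}{8}\,\|f''\|_\infty\,n^{-2}.$$ -/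

import Mathlib

open Set

/-- The B-spline of degree `m` and index `j` on the knot sequence `τ`, by the Cox-de Boor recursion
(a quotient with zero denominator counts as `0`). In degree `0` it is the indicator function of
`[τ j, τ (j+1))`; as usual, the last nonempty knot interval, the one that ends at the right endpoint
`b`, is taken to be closed. -/
noncomputable def coxDeBoor (τ : ℕ → ℝ) (b : ℝ) : ℕ → ℕ → ℝ → ℝ
  | 0, j, t =>
    open Classical in
    if (τ j ≤ t ∧ t < τ (j + 1)) ∨ (τ j < τ (j + 1) ∧ τ (j + 1) = b ∧ t = b) then 1 else 0
  | m + 1, j, t =>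
    (t - τ j) / (τ (j + m + 1) - τ j) * coxDeBoor τ b m j t
      + (τ (j + m + 2) - t) / (τ (j + m + 2) - τ (j + 1)) * coxDeBoor τ b m (j + 1) t

/-- `τ 0 ≤ ... ≤ τ (n+m+1)` is a clamped knot sequence on `[a, b]` for `n + 1` B-splines of
degree `m`: the first and the last `m + 1` knots are `a` and `b` respectively. Only the knots with
index at most `n + m + 1` matter. -/
structure IsClampedKnots (a b : ℝ) (m n : ℕ) (τ : ℕ → ℝ) : Prop where
  mono : MonotoneOn τ (Set.Icc 0 (n + m + 1))
  left : ∀ i, i ≤ m → τ i = a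
  right : ∀ i, n + 1 ≤ i → i ≤ n + m + 1 → τ i = b

/-- The continuous functions on `[a, b]` of the form `∑ c_j B_{j,m}`, `0 ≤ j ≤ n`. -/
def splineSpace (a b : ℝ) (m n : ℕ) (τ : ℕ → ℝ) : Set C(Icc a b, ℝ) :=
  {s | ∃ c : Fin (n + 1) → ℝ, ∀ x : Icc a b,
    s x = ∑ j : Fin (n + 1), c j * coxDeBoor τ b m (j : ℕ) (x : ℝ)}

theorem equiNode_mem {a b : ℝ} (hab : a ≤ b) (n : ℕ) (i : Fin (n + 1)) :
    a + (i : ℕ) * ((b - a) / n) ∈ Icc a b := by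
  have hi : ((i : ℕ) : ℝ) ≤ n := by exact_mod_cast Nat.lt_succ_iff.mp i.2
  have hba : 0 ≤ b - a := sub_nonneg.mpr hab
  have h0 : 0 ≤ (b - a) / (n : ℝ) := by positivity
  refine ⟨by have : 0 ≤ ((i : ℕ) : ℝ) * ((b - a) / n) := by positivity
             linarith, ?_⟩
  have h1 : ((i : ℕ) : ℝ) * ((b - a) / n) ≤ n * ((b - a) / n) := by gcongr
  have h2 : (n : ℝ) * ((b - a) / n) ≤ b - a := by
    rcases Nat.eq_zero_or_pos n with rfl | hn
    · simpa using hba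
    · have : (n : ℝ) ≠ 0 := by positivity
      exact le_of_eq (by field_simp)
  linarith

/-- The equidistant nodes `t_i = a + i (b - a) / n`, `0 ≤ i ≤ n`. -/
noncomputable def equiNode {a b : ℝ} (hab : a ≤ b) (n : ℕ) (i : Fin (n + 1)) : Icc a b :=
  ⟨a + (i : ℕ) * ((b - a) / n), equiNode_mem hab n i⟩

/-- The interpolation operator is well defined: every continuous function is interpolated at the
equidistant nodes by exactly one spline. -/
def InterpolationWellDefined {a b : ℝ} (hab : a ≤ b) (m n : ℕ) (τ : ℕ → ℝ) : Prop :=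
  ∀ g : C(Icc a b, ℝ), ∃! s : C(Icc a b, ℝ),
    s ∈ splineSpace a b m n τ ∧ ∀ i : Fin (n + 1), s (equiNode hab n i) = g (equiNode hab n i)

/-- The interpolation operator `I`: it sends `g` to the spline that interpolates `g`. -/
noncomputable def splineInterpolation {a b : ℝ} {hab : a ≤ b} {m n : ℕ} {τ : ℕ → ℝ}
    (hI : InterpolationWellDefined hab m n τ) (g : C(Icc a b, ℝ)) : C(Icc a b, ℝ) :=
  (hI g).exists.choose

/-- The set of quotients `‖I g‖ / ‖g‖`, with `g ≠ 0` continuous on `[a, b]` (sup norms). -/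
def interpolationRatios {a b : ℝ} {hab : a ≤ b} {m n : ℕ} {τ : ℕ → ℝ}
    (hI : InterpolationWellDefined hab m n τ) : Set ℝ :=
  {r | ∃ g : C(Icc a b, ℝ), g ≠ 0 ∧ r = ‖splineInterpolation hI g‖ / ‖g‖}

/-- The operator norm `‖I‖`, meaningful when `interpolationRatios hI` is bounded above. -/
noncomputable def interpolationNorm {a b : ℝ} {hab : a ≤ b} {m n : ℕ} {τ : ℕ → ℝ}
    (hI : InterpolationWellDefined hab m n τ) : ℝ :=
  sSup (interpolationRatios hI)

/-- A function that is continuous on `[a, b]`, as an element of `C([a, b])`. -/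
def toContIcc {a b : ℝ} (f : ℝ → ℝ) (hf : ContinuousOn f (Icc a b)) : C(Icc a b, ℝ) :=
  ⟨fun x => f x, continuousOn_iff_continuous_domRestrict.mp hf⟩

/-- The supremum norm on `[a, b]` (used only for functions that are continuous there). -/
noncomputable def supNormIcc (a b : ℝ) (u : ℝ → ℝ) : ℝ :=
  ⨆ x : Icc a b, |u x|

/-- The piecewise linear interpolant of `f` at the nodes `t_i = a + i (b - a) / n`. The point `t`
lies in `[t_i, t_{i+1}]`, where `i = min ⌊(t - a) / ((b - a) / n)⌋ (n - 1)`. -/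
noncomputable def piecewiseLinear (a b : ℝ) (n : ℕ) (f : ℝ → ℝ) (t : ℝ) : ℝ :=
  let h : ℝ := (b - a) / n
  let i : ℕ := min ⌊(t - a) / h⌋₊ (n - 1)
  let u : ℝ := a + (i : ℝ) * h
  let v : ℝ := a + ((i : ℝ) + 1) * h
  f u + (f v - f u) / (v - u) * (t - u)

/-! Since the interpolation operator `I` reproduces splines, Lebesgue's inequality bounds the
interpolation error by `1 + ‖I‖` times the distance of `f` to the spline space. That distance is
estimated with a quasi-interpolant in the style of de Boor and Fix. By Marsden's identity
`∑ B_j(t) ψ_j = (X - t) ^ m`, where `ψ_j = (X - τ (j+1)) ⋯ (X - τ (j+m))`, the functionals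
`λ_ξ ψ = (∑ k < m, (-1) ^ k ψ^(m-k)(ξ) f^(k)(ξ)) / m!` satisfy `∑ B_j(t) λ_t ψ_j = f t`, and the
derivative of `λ_ξ ψ_j` in `ξ` telescopes to a multiple of the product of `f^(m)` and the derivative
of `ψ_j`. Hence replacing `λ_t ψ_j` by its value at `ξ = τ j` costs `O(D ^ m ‖f^(m)‖)`, where `D`
bounds the lengths of the supports of the B-splines. If interpolation is well defined, then the
collocation matrix is invertible, some permutation of the nodes puts the `j`-th one into the support
of `B_j`, and by the pigeonhole principle the identity does so as well; for equidistant nodes this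
forces `D = O(1/n)`.

For the piecewise linear interpolant, a bound `M` on the second derivative makes `f` strongly convex
and strongly concave with modulus `-M`, which bounds its distance to every chord. -/

section BSpline

variable {τ : ℕ → ℝ} {a b t : ℝ} {m n k : ℕ}

theorem coxDeBoor_succ (τ : ℕ → ℝ) (b : ℝ) (k j : ℕ) (t : ℝ) :
    coxDeBoor τ b (k + 1) j t =
      (t - τ j) / (τ (j + k + 1) - τ j) * coxDeBoor τ b k j t
        + (τ (j + k + 2) - t) / (τ (j + k + 2) - τ (j + 1)) * coxDeBoor τ b k (j + 1) t := rfl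

theorem mem_Icc_knots_of_coxDeBoor_ne_zero {j : ℕ} (hτ : MonotoneOn τ (Icc j (j + k + 1)))
    (h : coxDeBoor τ b k j t ≠ 0) : t ∈ Icc (τ j) (τ (j + k + 1)) ∧ τ j < τ (j + k + 1) := by
  induction k generalizing j with
  | zero =>
    simp only [coxDeBoor, ne_eq, ite_eq_right_iff, one_ne_zero, imp_false, not_not] at h
    rcases h with ⟨hle, hlt⟩ | ⟨hlt, rfl, rfl⟩
    · exact ⟨⟨hle, hlt.le⟩, hle.trans_lt hlt⟩
    · exact ⟨⟨hlt.le, le_rfl⟩, hlt⟩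
  | succ k ih =>
    by_cases hj : coxDeBoor τ b k j t = 0
    · have hj' : coxDeBoor τ b k (j + 1) t ≠ 0 := fun h0 => h (by simp [coxDeBoor_succ, hj, h0])
      have e : j + 1 + k + 1 = j + (k + 1) + 1 := by ring
      obtain ⟨⟨hl, hr⟩, hlt⟩ := ih (e ▸ hτ.mono (Icc_subset_Icc_left j.le_succ)) hj'
      rw [e] at hr hlt
      have hstep : τ j ≤ τ (j + 1) := hτ ⟨le_rfl, by omega⟩ ⟨by omega, by omega⟩ j.le_succ
      exact ⟨⟨hstep.trans hl, hr⟩, hstep.trans_lt hlt⟩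
    · obtain ⟨⟨hl, hr⟩, hlt⟩ := ih (hτ.mono (Icc_subset_Icc_right (by omega))) hj
      have hstep : τ (j + k + 1) ≤ τ (j + (k + 1) + 1) :=
        hτ ⟨by omega, by omega⟩ ⟨by omega, le_rfl⟩ (by omega)
      exact ⟨⟨hl, hr.trans hstep⟩, hlt.trans_le hstep⟩

theorem coxDeBoor_eq_zero_of_knots_eq {j : ℕ} (hτ : MonotoneOn τ (Icc j (j + k + 1)))
    (h : τ j = τ (j + k + 1)) : coxDeBoor τ b k j t = 0 := by
  by_contra h0
  exact (mem_Icc_knots_of_coxDeBoor_ne_zero hτ h0).2.ne h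

theorem coxDeBoor_nonneg {j : ℕ} (hτ : MonotoneOn τ (Icc j (j + k + 1))) :
    0 ≤ coxDeBoor τ b k j t := by
  induction k generalizing j with
  | zero =>
    rw [coxDeBoor]
    split_ifs <;> norm_num
  | succ k ih =>
    have hleft : MonotoneOn τ (Icc j (j + k + 1)) := hτ.mono (Icc_subset_Icc_right (by omega))
    have hright : MonotoneOn τ (Icc (j + 1) (j + 1 + k + 1)) :=
      hτ.mono (Icc_subset_Icc (by omega) (by omega))
    rw [coxDeBoor_succ]
    refine add_nonneg ?_ ?_
    · by_cases h : coxDeBoor τ b k j t = 0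
      · simp [h]
      · obtain ⟨⟨hl, -⟩, hlt⟩ := mem_Icc_knots_of_coxDeBoor_ne_zero hleft h
        exact mul_nonneg (div_nonneg (sub_nonneg.mpr hl) (sub_nonneg.mpr hlt.le)) (ih hleft)
    · by_cases h : coxDeBoor τ b k (j + 1) t = 0
      · simp [h]
      · obtain ⟨⟨-, hr⟩, hlt⟩ := mem_Icc_knots_of_coxDeBoor_ne_zero hright h
        rw [show j + 1 + k + 1 = j + k + 2 by ring] at hr hlt
        exact mul_nonneg (div_nonneg (sub_nonneg.mpr hr) (sub_nonneg.mpr hlt.le)) (ih hright)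

namespace IsClampedKnots

theorem knot_le_knot (h : IsClampedKnots a b m n τ) {i j : ℕ} (hij : i ≤ j) (hj : j ≤ n + m + 1) :
    τ i ≤ τ j :=
  h.mono ⟨i.zero_le, hij.trans hj⟩ ⟨j.zero_le, hj⟩ hij

theorem knot_mem_Icc (h : IsClampedKnots a b m n τ) {j : ℕ} (hj : j ≤ n + m + 1) : τ j ∈ Icc a b :=
  ⟨h.left 0 m.zero_le ▸ h.knot_le_knot j.zero_le hj,
    h.right (n + m + 1) (by omega) le_rfl ▸ h.knot_le_knot hj le_rfl⟩

theorem monotoneOn_Icc (h : IsClampedKnots a b m n τ) {j : ℕ} (hk : k ≤ m) (hj : j ≤ n) :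
    MonotoneOn τ (Icc j (j + k + 1)) :=
  h.mono.mono (Icc_subset_Icc j.zero_le (by omega))

theorem coxDeBoor_first_eq_zero (h : IsClampedKnots a b m n τ) (hk : k < m) :
    coxDeBoor τ b k 0 t = 0 :=
  coxDeBoor_eq_zero_of_knots_eq (h.monotoneOn_Icc hk.le n.zero_le)
    (by rw [h.left 0 m.zero_le, h.left _ (by omega)])

theorem coxDeBoor_last_eq_zero (h : IsClampedKnots a b m n τ) (hk : k < m) :
    coxDeBoor τ b k (n + 1) t = 0 :=
  coxDeBoor_eq_zero_of_knots_eq (h.mono.mono (Icc_subset_Icc (Nat.zero_le _) (by omega)))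
    (by rw [h.right (n + 1) le_rfl (by omega), h.right _ (by omega) (by omega)])

theorem sum_coxDeBoor_zero (h : IsClampedKnots a b m n τ) (hab : a < b) (ht : t ∈ Icc a b) :
    ∑ j ∈ Finset.range (n + 1), coxDeBoor τ b 0 j t = 1 := by
  -- The indicator of `{j | τ j ≤ t ∧ τ j < b}` drops from `1` to `0` exactly at the knot interval
  -- containing `t`, so the sum telescopes.
  let g : ℕ → ℝ := fun j => if τ j ≤ t ∧ τ j < b then 1 else 0
  have hg : ∀ j ∈ Finset.range (n + 1), coxDeBoor τ b 0 j t = g j - g (j + 1) := by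
    intro j hj
    have hj := Finset.mem_range.mp hj
    have hmono : τ j ≤ τ (j + 1) := h.knot_le_knot j.le_succ (by omega)
    have hτb : τ (j + 1) ≤ b := (h.knot_mem_Icc (by omega)).2
    have htb : t ≤ b := ht.2
    simp only [coxDeBoor, g]
    split_ifs <;> first | (norm_num; done) | (exfalso; grind)
  rw [Finset.sum_congr rfl hg, Finset.sum_range_sub']
  simp [g, h.left 0 m.zero_le, h.right (n + 1) le_rfl (by omega), hab, ht.1]

/-- One step of de Boor's algorithm. The junk value `c (0 - 1) = c 0` is harmless, as it multiplies
`coxDeBoor τ b k 0 t = 0`. -/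
theorem sum_coxDeBoor_succ_smul (h : IsClampedKnots a b m n τ) (hk : k < m) {E : Type*}
    [AddCommGroup E] [Module ℝ E] (c : ℕ → E) :
    ∑ j ∈ Finset.range (n + 1), coxDeBoor τ b (k + 1) j t • c j =
      ∑ j ∈ Finset.range (n + 1), coxDeBoor τ b k j t •
        (((t - τ j) / (τ (j + k + 1) - τ j)) • c j
          + ((τ (j + k + 1) - t) / (τ (j + k + 1) - τ j)) • c (j - 1)) := by
  let Y : ℕ → E := fun j =>
    coxDeBoor τ b k j t • ((τ (j + k + 1) - t) / (τ (j + k + 1) - τ j)) • c (j - 1)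
  have hY0 : Y 0 = 0 := by simp only [Y, h.coxDeBoor_first_eq_zero hk, zero_smul]
  have hYn : Y (n + 1) = 0 := by simp only [Y, h.coxDeBoor_last_eq_zero hk, zero_smul]
  have hshift : ∑ j ∈ Finset.range (n + 1), Y (j + 1) = ∑ j ∈ Finset.range (n + 1), Y j := by
    have := Finset.sum_range_succ' Y (n + 1)
    rwa [Finset.sum_range_succ, hY0, hYn, add_zero, add_zero, eq_comm] at this
  simp only [smul_add, Finset.sum_add_distrib]
  rw [← hshift, ← Finset.sum_add_distrib]
  refine Finset.sum_congr rfl fun j _ => ?_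
  simp only [Y, coxDeBoor_succ, add_smul, smul_smul, add_tsub_cancel_right, mul_comm,
    show j + 1 + k + 1 = j + k + 2 by ring]

open Polynomial Lagrange

theorem marsden_identity (h : IsClampedKnots a b m n τ) (hab : a < b) (ht : t ∈ Icc a b)
    (hk : k ≤ m) :
    ∑ j ∈ Finset.range (n + 1), coxDeBoor τ b k j t • nodal (Finset.Ioc j (j + k)) τ
      = (X - C t) ^ k := by
  induction k with
  | zero => simp [← Finset.sum_smul, h.sum_coxDeBoor_zero hab ht]
  | succ k ih =>
    rw [h.sum_coxDeBoor_succ_smul hk, pow_succ, ← ih (by omega), Finset.sum_mul]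
    refine Finset.sum_congr rfl fun j hj => ?_
    have hj := Finset.mem_range.mp hj
    by_cases h0 : coxDeBoor τ b k j t = 0
    · simp [h0]
    have hj0 : j ≠ 0 := by
      rintro rfl
      exact h0 (h.coxDeBoor_first_eq_zero hk)
    have hlt : τ j < τ (j + k + 1) :=
      (mem_Icc_knots_of_coxDeBoor_ne_zero (h.monotoneOn_Icc (by omega) (by omega)) h0).2
    have hne : τ (j + k + 1) - τ j ≠ 0 := sub_ne_zero.mpr hlt.ne'
    have hright : nodal (Finset.Ioc j (j + (k + 1))) τ
        = (X - C (τ (j + k + 1))) * nodal (Finset.Ioc j (j + k)) τ := by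
      rw [← nodal_insert_eq_nodal (by simp)]
      congr 1
      grind
    have hleft : nodal (Finset.Ioc (j - 1) (j - 1 + (k + 1))) τ
        = (X - C (τ j)) * nodal (Finset.Ioc j (j + k)) τ := by
      rw [← nodal_insert_eq_nodal (by simp)]
      congr 1
      grind
    rw [hright, hleft, smul_mul_assoc]
    congr 1
    refine Polynomial.funext fun x => ?_
    simp only [eval_add, eval_smul, eval_mul, eval_sub, eval_X, eval_C, smul_eq_mul]
    field_simp
    ring

theorem sum_coxDeBoor_eq_one (h : IsClampedKnots a b m n τ) (hab : a < b) (ht : t ∈ Icc a b) :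
    ∑ j ∈ Finset.range (n + 1), coxDeBoor τ b m j t = 1 := by
  have hψ : ∀ j, (nodal (Finset.Ioc j (j + m)) τ).coeff m = 1 := fun j => by
    simpa [natDegree_nodal] using (nodal_monic (s := Finset.Ioc j (j + m)) (v := τ)).coeff_natDegree
  have hX : ((X - C t) ^ m).coeff m = 1 := by
    simpa using ((monic_X_sub_C t).pow m).coeff_natDegree
  have := congrArg (coeff · m) (h.marsden_identity hab ht le_rfl)
  simpa [finsetSum_coeff, hψ, hX] using this

end IsClampedKnots

end BSpline

section DeBoorFix

open Polynomial Lagrange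

/-- The de Boor-Fix functional of order `m` at `ξ`, as a linear map in the polynomial that
represents it: `ψ ↦ (∑ k < m, (-1) ^ k ψ^(m-k)(ξ) f^(k)(ξ)) / m!`, the derivatives of `f` being
taken within `s`. For `ψ = (X - τ (j+1)) ⋯ (X - τ (j+m))` and a polynomial `f` of degree less than
`m` this is the coefficient of `f` at the `j`-th B-spline. The usual term `k = m` is left out, so
that the functional of a `C^m` function is differentiable in `ξ`. -/
noncomputable def deBoorFix (m : ℕ) (s : Set ℝ) (f : ℝ → ℝ) (ξ : ℝ) : ℝ[X] →ₗ[ℝ] ℝ :=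
  (m.factorial : ℝ)⁻¹ • ∑ k ∈ Finset.range m,
    ((-1) ^ k * iteratedDerivWithin k f s ξ) • (leval ξ ∘ₗ derivative ^ (m - k))

variable {s : Set ℝ} {f : ℝ → ℝ} {m : ℕ} {ξ : ℝ}

theorem deBoorFix_apply (ψ : ℝ[X]) :
    deBoorFix m s f ξ ψ = (m.factorial : ℝ)⁻¹ * ∑ k ∈ Finset.range m,
      (-1) ^ k * (iteratedDerivWithin k f s ξ * (derivative^[m - k] ψ).eval ξ) := by
  simp [deBoorFix, leval_apply, Module.End.pow_apply, mul_assoc]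

theorem deBoorFix_X_sub_C_pow (hm : 1 ≤ m) : deBoorFix m s f ξ ((X - C ξ) ^ m) = f ξ := by
  have hm0 : (m.factorial : ℝ) ≠ 0 := by positivity
  rw [deBoorFix_apply, Finset.sum_eq_single_of_mem 0 (by simp; omega)]
  · simp [iterate_derivative_X_sub_pow, hm0, mul_comm, Nat.descFactorial_self]
  · intro k hk hk0
    have hkm := Finset.mem_range.mp hk
    simp [iterate_derivative_X_sub_pow, Nat.sub_sub_self hkm.le, hk0]

theorem hasDerivWithinAt_iteratedDerivWithin {k : ℕ} (hs : UniqueDiffOn ℝ s)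
    (hf : ContDiffOn ℝ m f s) (hk : k < m) (hξ : ξ ∈ s) :
    HasDerivWithinAt (iteratedDerivWithin k f s) (iteratedDerivWithin (k + 1) f s ξ) s ξ := by
  rw [iteratedDerivWithin_succ]
  exact (hf.differentiableOn_iteratedDerivWithin (by exact_mod_cast hk) hs ξ hξ).hasDerivWithinAt

theorem hasDerivWithinAt_sum_alternating_derivatives (hs : UniqueDiffOn ℝ s)
    (hf : ContDiffOn ℝ m f s) (ψ : ℝ[X]) (hξ : ξ ∈ s) {N : ℕ} (hN : N ≤ m) :
    HasDerivWithinAt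
      (fun x => ∑ k ∈ Finset.range N,
        (-1) ^ k * (iteratedDerivWithin k f s x * (derivative^[m - k] ψ).eval x))
      (f ξ * (derivative^[m + 1] ψ).eval ξ
        - (-1) ^ N * (iteratedDerivWithin N f s ξ * (derivative^[m + 1 - N] ψ).eval ξ)) s ξ := by
  induction N with
  | zero => simpa using hasDerivWithinAt_const ξ s (0 : ℝ)
  | succ N ih =>
    simp only [Finset.sum_range_succ]
    have hterm := ((hasDerivWithinAt_iteratedDerivWithin hs hf hN hξ).mul
      ((derivative^[m - N] ψ).hasDerivAt ξ).hasDerivWithinAt).const_mul ((-1 : ℝ) ^ N)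
    refine ((ih (by omega)).add hterm).congr_deriv ?_
    rw [← Function.iterate_succ_apply' derivative, Nat.succ_eq_add_one,
      show m - N + 1 = m + 1 - N by omega, show m + 1 - (N + 1) = m - N by omega]
    ring

theorem hasDerivWithinAt_deBoorFix (hs : UniqueDiffOn ℝ s) (hf : ContDiffOn ℝ m f s) {ψ : ℝ[X]}
    (hψ : ψ.natDegree ≤ m) (hξ : ξ ∈ s) :
    HasDerivWithinAt (fun x => deBoorFix m s f x ψ)
      ((m.factorial : ℝ)⁻¹ * -((-1) ^ m * (iteratedDerivWithin m f s ξ * ψ.derivative.eval ξ)))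
      s ξ := by
  simp only [deBoorFix_apply]
  refine ((hasDerivWithinAt_sum_alternating_derivatives hs hf ψ hξ le_rfl).const_mul
    _).congr_deriv ?_
  simp [iterate_derivative_eq_zero (Nat.lt_succ_of_le hψ)]

theorem abs_eval_derivative_nodal_le {ι : Type*} (S : Finset ι) (v : ι → ℝ) {D : ℝ}
    (h : ∀ i ∈ S, |ξ - v i| ≤ D) :
    |(derivative (nodal S v)).eval ξ| ≤ S.card * D ^ (S.card - 1) := by
  classical
  rw [derivative_nodal, eval_finsetSum, ← nsmul_eq_mul]
  refine (Finset.abs_sum_le_sum_abs _ _).trans (Finset.sum_le_card_nsmul _ _ _ fun i hi => ?_)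
  rw [eval_nodal, Finset.abs_prod, ← Finset.card_erase_of_mem hi]
  exact (Finset.prod_le_prod (fun _ _ => abs_nonneg _) fun j hj =>
    h j (Finset.mem_of_mem_erase hj)).trans_eq (Finset.prod_const D)

theorem abs_deBoorFix_nodal_sub_le {ι : Type*} {S : Finset ι} {v : ι → ℝ} {p q x y M : ℝ}
    (hs : UniqueDiffOn ℝ s) (hf : ContDiffOn ℝ m f s) (hm : 1 ≤ m) (hS : S.card = m)
    (hpq : Icc p q ⊆ s) (hv : ∀ i ∈ S, v i ∈ Icc p q)
    (hM : ∀ ξ ∈ Icc p q, |iteratedDerivWithin m f s ξ| ≤ M) (hx : x ∈ Icc p q)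
    (hy : y ∈ Icc p q) :
    |deBoorFix m s f y (nodal S v) - deBoorFix m s f x (nodal S v)|
      ≤ M * (q - p) ^ m / (m - 1).factorial := by
  have hqp : 0 ≤ q - p := sub_nonneg.mpr (hx.1.trans hx.2)
  have hM0 : 0 ≤ M := (abs_nonneg _).trans (hM x hx)
  have hderiv : ∀ ξ ∈ Icc p q, ‖(m.factorial : ℝ)⁻¹ *
      -((-1) ^ m * (iteratedDerivWithin m f s ξ * (nodal S v).derivative.eval ξ))‖
        ≤ (m.factorial : ℝ)⁻¹ * (M * (m * (q - p) ^ (m - 1))) := by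
    intro ξ hξ
    have hnodal : |(nodal S v).derivative.eval ξ| ≤ m * (q - p) ^ (m - 1) :=
      hS ▸ abs_eval_derivative_nodal_le S v fun i hi => Real.dist_le_of_mem_Icc hξ (hv i hi)
    simp only [norm_mul, norm_neg, norm_pow, norm_one, one_pow, one_mul, norm_inv,
      RCLike.norm_natCast, Real.norm_eq_abs]
    gcongr
    exact hM ξ hξ
  have hmvt := (convex_Icc p q).norm_image_sub_le_of_norm_hasDerivWithin_le
    (fun ξ hξ => (hasDerivWithinAt_deBoorFix hs hf (by rw [natDegree_nodal, hS])
      (hpq hξ)).mono hpq) hderiv hx hy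
  have hfac : (m.factorial : ℝ) = m * (m - 1).factorial := by
    exact_mod_cast (Nat.mul_factorial_pred (by omega)).symm
  have hm0 : (m : ℝ) ≠ 0 := by positivity
  calc _ ≤ (m.factorial : ℝ)⁻¹ * (M * (m * (q - p) ^ (m - 1))) * |y - x| := hmvt
    _ ≤ (m.factorial : ℝ)⁻¹ * (M * (m * (q - p) ^ (m - 1))) * (q - p) := by
      gcongr
      exact Real.dist_le_of_mem_Icc hy hx
    _ = M * ((q - p) ^ (m - 1) * (q - p)) / (m - 1).factorial := by
      rw [hfac]
      field_simp
    _ = M * (q - p) ^ m / (m - 1).factorial := by rw [pow_sub_one_mul (by omega)]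

end DeBoorFix

section QuasiInterpolant

open Polynomial Lagrange

/-- The `j`-th coefficient of the de Boor-Fix quasi-interpolant of degree `m`, for which the
functional is evaluated at the left end of the support of the `j`-th B-spline. -/
noncomputable def quasiCoeff (m : ℕ) (s : Set ℝ) (f : ℝ → ℝ) (τ : ℕ → ℝ) (j : ℕ) : ℝ :=
  deBoorFix m s f (τ j) (nodal (Finset.Ioc j (j + m)) τ)

variable {τ : ℕ → ℝ} {a b t : ℝ} {m n : ℕ} {f : ℝ → ℝ}

namespace IsClampedKnots

theorem sum_coxDeBoor_mul_deBoorFix (h : IsClampedKnots a b m n τ) (hab : a < b) (hm : 1 ≤ m)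
    (s : Set ℝ) (f : ℝ → ℝ) (ht : t ∈ Icc a b) :
    ∑ j ∈ Finset.range (n + 1),
      coxDeBoor τ b m j t * deBoorFix m s f t (nodal (Finset.Ioc j (j + m)) τ) = f t := by
  rw [← deBoorFix_X_sub_C_pow (s := s) (f := f) (ξ := t) hm,
    ← h.marsden_identity hab ht le_rfl, map_sum]
  simp only [map_smul, smul_eq_mul]

theorem abs_deBoorFix_sub_quasiCoeff_le (h : IsClampedKnots a b m n τ) (hab : a < b) (hm : 1 ≤ m)
    (hf : ContDiffOn ℝ m f (Icc a b)) {D M : ℝ} {j : ℕ} (hj : j ≤ n)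
    (hD : τ (j + m + 1) - τ j ≤ D)
    (hM : ∀ x ∈ Icc a b, |iteratedDerivWithin m f (Icc a b) x| ≤ M)
    (ht : t ∈ Icc (τ j) (τ (j + m + 1))) :
    |deBoorFix m (Icc a b) f t (nodal (Finset.Ioc j (j + m)) τ) - quasiCoeff m (Icc a b) f τ j|
      ≤ M * D ^ m / (m - 1).factorial := by
  have hsub : Icc (τ j) (τ (j + m + 1)) ⊆ Icc a b :=
    Icc_subset_Icc (h.knot_mem_Icc (by omega)).1 (h.knot_mem_Icc (by omega)).2
  have hknots : ∀ i ∈ Finset.Ioc j (j + m), τ i ∈ Icc (τ j) (τ (j + m + 1)) := fun i hi => by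
    rw [Finset.mem_Ioc] at hi
    exact ⟨h.knot_le_knot (by omega) (by omega), h.knot_le_knot (by omega) (by omega)⟩
  have hlen : 0 ≤ τ (j + m + 1) - τ j := sub_nonneg.mpr (ht.1.trans ht.2)
  have hM0 : 0 ≤ M := (abs_nonneg _).trans (hM t (hsub ht))
  refine (abs_deBoorFix_nodal_sub_le (uniqueDiffOn_Icc hab) hf hm (by simp) hsub hknots
    (fun ξ hξ => hM ξ (hsub hξ)) (left_mem_Icc.mpr (ht.1.trans ht.2)) ht).trans ?_
  gcongr

theorem abs_sub_sum_quasiCoeff_le (h : IsClampedKnots a b m n τ) (hab : a < b) (hm : 1 ≤ m)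
    (hf : ContDiffOn ℝ m f (Icc a b)) {D M : ℝ} (hD : ∀ j ≤ n, τ (j + m + 1) - τ j ≤ D)
    (hM : ∀ x ∈ Icc a b, |iteratedDerivWithin m f (Icc a b) x| ≤ M) (ht : t ∈ Icc a b) :
    |f t - ∑ j ∈ Finset.range (n + 1), quasiCoeff m (Icc a b) f τ j * coxDeBoor τ b m j t|
      ≤ M * D ^ m / (m - 1).factorial := by
  set δ : ℕ → ℝ := fun j =>
    deBoorFix m (Icc a b) f t (nodal (Finset.Ioc j (j + m)) τ) - quasiCoeff m (Icc a b) f τ j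
    with hδ
  have hterm : ∀ j ∈ Finset.range (n + 1), |coxDeBoor τ b m j t * δ j|
      ≤ coxDeBoor τ b m j t * (M * D ^ m / (m - 1).factorial) := by
    intro j hj
    have hjn : j ≤ n := Finset.mem_range_succ_iff.mp hj
    have hmono := h.monotoneOn_Icc le_rfl hjn
    by_cases h0 : coxDeBoor τ b m j t = 0
    · simp [h0]
    rw [abs_mul, abs_of_nonneg (coxDeBoor_nonneg hmono)]
    exact mul_le_mul_of_nonneg_left (h.abs_deBoorFix_sub_quasiCoeff_le hab hm hf hjn (hD j hjn) hM
      (mem_Icc_knots_of_coxDeBoor_ne_zero hmono h0).1) (coxDeBoor_nonneg hmono)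
  calc |f t - ∑ j ∈ Finset.range (n + 1), quasiCoeff m (Icc a b) f τ j * coxDeBoor τ b m j t|
    _ = |∑ j ∈ Finset.range (n + 1), coxDeBoor τ b m j t * δ j| := by
      conv_lhs => rw [← h.sum_coxDeBoor_mul_deBoorFix hab hm (Icc a b) f ht]
      rw [← Finset.sum_sub_distrib]
      simp only [hδ, mul_sub, mul_comm]
    _ ≤ ∑ j ∈ Finset.range (n + 1), coxDeBoor τ b m j t * (M * D ^ m / (m - 1).factorial) :=
      (Finset.abs_sum_le_sum_abs _ _).trans (Finset.sum_le_sum hterm)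
    _ = M * D ^ m / (m - 1).factorial := by
      rw [← Finset.sum_mul, h.sum_coxDeBoor_eq_one hab ht, one_mul]

end IsClampedKnots

end QuasiInterpolant

section SchoenbergWhitney

theorem exists_perm_forall_apply_ne_zero_of_det_ne_zero {ι R : Type*} [Fintype ι] [DecidableEq ι]
    [CommRing R] {A : Matrix ι ι R} (hA : A.det ≠ 0) :
    ∃ σ : Equiv.Perm ι, ∀ i, A (σ i) i ≠ 0 := by
  rw [Matrix.det_apply'] at hA
  obtain ⟨σ, -, hσ⟩ := Finset.exists_ne_zero_of_sum_ne_zero hA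
  exact ⟨σ, fun i hi => right_ne_zero_of_mul hσ (Finset.prod_eq_zero (Finset.mem_univ i) hi)⟩

theorem exists_le_and_le_apply_of_injective {α : Type*} [LinearOrder α] [LocallyFiniteOrderBot α]
    {σ : α → α} (hσ : Function.Injective σ) (k : α) : ∃ i ≤ k, k ≤ σ i := by
  by_contra! h
  have hcard : (Finset.Iio k).card < (Finset.Iic k).card :=
    Finset.card_lt_card ⟨Finset.Iio_subset_Iic_self, fun hsub =>
      (Finset.mem_Iio.mp (hsub (Finset.mem_Iic.mpr le_rfl))).false⟩
  obtain ⟨i, -, j, -, hij, he⟩ := Finset.exists_ne_map_eq_of_card_lt_of_maps_to hcard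
    fun i hi => Finset.mem_Iio.mpr (h i (Finset.mem_Iic.mp hi))
  exact hij (hσ he)

theorem exists_ge_and_apply_le_of_injective {α : Type*} [LinearOrder α] [LocallyFiniteOrderTop α]
    {σ : α → α} (hσ : Function.Injective σ) (k : α) : ∃ i ≥ k, σ i ≤ k :=
  exists_le_and_le_apply_of_injective (α := αᵒᵈ) hσ k

/-- The collocation matrix, which maps the B-spline coefficients of a spline of degree `m` to its
values at the points `x i`. -/
noncomputable def collocationMatrix {n : ℕ} (τ : ℕ → ℝ) (b : ℝ) (m : ℕ) (x : Fin (n + 1) → ℝ) :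
    Matrix (Fin (n + 1)) (Fin (n + 1)) ℝ :=
  Matrix.of fun i j => coxDeBoor τ b m j (x i)

variable {τ : ℕ → ℝ} {a b : ℝ} {m n : ℕ}

theorem collocationMatrix_mulVec (x c : Fin (n + 1) → ℝ) (i : Fin (n + 1)) :
    (collocationMatrix τ b m x).mulVec c i = ∑ j, c j * coxDeBoor τ b m j (x i) := by
  simp only [collocationMatrix, Matrix.mulVec, dotProduct, Matrix.of_apply, mul_comm]

/-- The necessity part of the Schoenberg-Whitney theorem. -/
theorem IsClampedKnots.mem_Icc_of_det_collocationMatrix_ne_zero (h : IsClampedKnots a b m n τ)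
    {x : Fin (n + 1) → ℝ} (hx : Monotone x) (hdet : (collocationMatrix τ b m x).det ≠ 0)
    (k : Fin (n + 1)) : x k ∈ Icc (τ k) (τ (k + m + 1)) := by
  obtain ⟨σ, hσ⟩ := exists_perm_forall_apply_ne_zero_of_det_ne_zero hdet
  have hmem (i : Fin (n + 1)) : x (σ i) ∈ Icc (τ i) (τ (i + m + 1)) :=
    (mem_Icc_knots_of_coxDeBoor_ne_zero (h.monotoneOn_Icc le_rfl i.is_le) (hσ i)).1
  obtain ⟨i, hki, hik⟩ := exists_ge_and_apply_le_of_injective σ.injective k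
  obtain ⟨j, hjk, hkj⟩ := exists_le_and_le_apply_of_injective σ.injective k
  exact ⟨(h.knot_le_knot (Fin.val_le_of_le hki) (by omega)).trans ((hmem i).1.trans (hx hik)),
    (hx hkj).trans ((hmem j).2.trans (h.knot_le_knot (by gcongr; exact hjk) (by omega)))⟩

end SchoenbergWhitney

section Collocation

variable {τ : ℕ → ℝ} {a b : ℝ} {m n : ℕ}

theorem exists_continuousMap_apply_eq {ι : Type*} [Finite ι] {s : Set ℝ} {x : ι → s}
    (hx : Function.Injective x) (v : ι → ℝ) : ∃ g : C(s, ℝ), ∀ i, g (x i) = v i := by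
  classical
  have := Fintype.ofFinite ι
  exact ⟨(Lagrange.interpolate Finset.univ (fun i => (x i : ℝ)) v).toContinuousMapOn s, fun i =>
    Lagrange.eval_interpolate_at_node v (Subtype.val_injective.comp hx).injOn (Finset.mem_univ i)⟩

theorem strictMono_equiNode (hab : a < b) (hn : 1 ≤ n) : StrictMono (equiNode hab.le n) := by
  intro i j hij
  have : 0 < (b - a) / n := div_pos (sub_pos.mpr hab) (by exact_mod_cast hn)
  have hij : (i : ℝ) < j := by exact_mod_cast hij
  simp only [equiNode, Subtype.mk_lt_mk]
  gcongr

namespace InterpolationWellDefined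

theorem isUnit_collocationMatrix {hab : a ≤ b} (hI : InterpolationWellDefined hab m n τ)
    (hinj : Function.Injective (equiNode hab n)) :
    IsUnit (collocationMatrix τ b m fun i : Fin (n + 1) => (equiNode hab n i : ℝ)) := by
  refine Matrix.mulVec_surjective_iff_isUnit.mp fun v => ?_
  obtain ⟨g, hg⟩ := exists_continuousMap_apply_eq hinj v
  obtain ⟨s, ⟨c, hc⟩, hs⟩ := (hI g).exists
  refine ⟨c, funext fun i => ?_⟩
  rw [collocationMatrix_mulVec, ← hc, hs, hg]

theorem exists_eq_sum_coxDeBoor {hab : a ≤ b} (hI : InterpolationWellDefined hab m n τ)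
    (hinj : Function.Injective (equiNode hab n)) (c : Fin (n + 1) → ℝ) :
    ∃ s : C(Icc a b, ℝ), ∀ x : Icc a b, s x = ∑ j, c j * coxDeBoor τ b m (j : ℕ) (x : ℝ) := by
  obtain ⟨g, hg⟩ := exists_continuousMap_apply_eq hinj
    ((collocationMatrix τ b m fun i : Fin (n + 1) => (equiNode hab n i : ℝ)).mulVec c)
  obtain ⟨s, ⟨c', hc'⟩, hs⟩ := (hI g).exists
  obtain rfl : c' = c := by
    refine Matrix.mulVec_injective_iff_isUnit.mpr (hI.isUnit_collocationMatrix hinj)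
      (funext fun i => ?_)
    rw [← hg, ← hs, hc', collocationMatrix_mulVec]
  exact ⟨s, hc'⟩

end InterpolationWellDefined

theorem IsClampedKnots.knots_sub_le (h : IsClampedKnots a b m n τ) (hab : a ≤ b) (hn : 1 ≤ n)
    (hSW : ∀ k : Fin (n + 1), (equiNode hab n k : ℝ) ∈ Icc (τ k) (τ (k + m + 1))) {j : ℕ}
    (hj : j ≤ n) : τ (j + m + 1) - τ j ≤ (2 * m + 2) * ((b - a) / n) := by
  set d : ℝ := (b - a) / n
  have hd0 : 0 ≤ d := div_nonneg (sub_nonneg.mpr hab) n.cast_nonneg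
  have hnd : n * d = b - a := mul_div_cancel₀ _ (by positivity)
  have hupper : τ (j + m + 1) ≤ a + (j + m + 1) * d := by
    rcases le_or_gt (j + m + 1) n with hle | hlt
    · simpa [equiNode] using (hSW ⟨j + m + 1, by omega⟩).1
    · have : (n : ℝ) ≤ j + m + 1 := by exact_mod_cast hlt.le
      rw [h.right _ hlt (by omega)]
      nlinarith
  have hlower : a + (j - (m + 1)) * d ≤ τ j := by
    rcases le_or_gt j m with hle | hlt
    · have : (j : ℝ) ≤ m := by exact_mod_cast hle
      rw [h.left j hle]
      nlinarith
    · obtain ⟨k, rfl⟩ : ∃ k, j = k + m + 1 := ⟨j - m - 1, by omega⟩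
      simpa [equiNode, add_assoc] using (hSW ⟨k, by omega⟩).2
  linarith

end Collocation

section Interpolation

variable {τ : ℕ → ℝ} {a b : ℝ} {m n : ℕ} {hab : a ≤ b}

theorem splineInterpolation_eq (hI : InterpolationWellDefined hab m n τ) {g s : C(Icc a b, ℝ)}
    (hs : s ∈ splineSpace a b m n τ) (hg : ∀ i, s (equiNode hab n i) = g (equiNode hab n i)) :
    splineInterpolation hI g = s :=
  (hI g).unique (hI g).exists.choose_spec ⟨hs, hg⟩

theorem splineInterpolation_sub (hI : InterpolationWellDefined hab m n τ) (f : C(Icc a b, ℝ))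
    {s : C(Icc a b, ℝ)} (hs : s ∈ splineSpace a b m n τ) :
    splineInterpolation hI (f - s) = splineInterpolation hI f - s := by
  obtain ⟨⟨c, hc⟩, hv⟩ : splineInterpolation hI f ∈ splineSpace a b m n τ ∧
    ∀ i, splineInterpolation hI f (equiNode hab n i) = f (equiNode hab n i) :=
    (hI f).exists.choose_spec
  obtain ⟨d, hd⟩ := hs
  refine splineInterpolation_eq hI ⟨c - d, fun x => ?_⟩ fun i => ?_
  · simp only [ContinuousMap.sub_apply, hc, hd, Pi.sub_apply, sub_mul, Finset.sum_sub_distrib]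
  · simp only [ContinuousMap.sub_apply, hv]

theorem norm_splineInterpolation_le (hI : InterpolationWellDefined hab m n τ)
    (hB : BddAbove (interpolationRatios hI)) (g : C(Icc a b, ℝ)) :
    ‖splineInterpolation hI g‖ ≤ interpolationNorm hI * ‖g‖ := by
  rcases eq_or_ne g 0 with rfl | hg
  · rw [splineInterpolation_eq hI (s := 0) ⟨0, by simp⟩ fun _ => rfl]
    simp
  · rw [← div_le_iff₀ (norm_pos_iff.mpr hg)]
    exact le_csSup hB ⟨g, hg, rfl⟩

theorem interpolationNorm_nonneg (hI : InterpolationWellDefined hab m n τ) :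
    0 ≤ interpolationNorm hI := by
  refine Real.sSup_nonneg ?_
  rintro _ ⟨g, -, rfl⟩
  positivity

/-- Lebesgue's inequality. -/
theorem norm_sub_splineInterpolation_le (hI : InterpolationWellDefined hab m n τ)
    (hB : BddAbove (interpolationRatios hI)) (f : C(Icc a b, ℝ)) {s : C(Icc a b, ℝ)}
    (hs : s ∈ splineSpace a b m n τ) :
    ‖f - splineInterpolation hI f‖ ≤ (1 + interpolationNorm hI) * ‖f - s‖ :=
  calc ‖f - splineInterpolation hI f‖
    _ = ‖(f - s) - splineInterpolation hI (f - s)‖ := by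
      rw [splineInterpolation_sub hI f hs, sub_sub_sub_cancel_right]
    _ ≤ ‖f - s‖ + ‖splineInterpolation hI (f - s)‖ := norm_sub_le _ _
    _ ≤ ‖f - s‖ + interpolationNorm hI * ‖f - s‖ := by
      gcongr
      exact norm_splineInterpolation_le hI hB _
    _ = (1 + interpolationNorm hI) * ‖f - s‖ := by ring

theorem abs_le_supNormIcc {u : ℝ → ℝ} (hu : ContinuousOn u (Icc a b)) {x : ℝ}
    (hx : x ∈ Icc a b) : |u x| ≤ supNormIcc a b u := by
  obtain ⟨K, hK⟩ := isCompact_Icc.bddAbove_image hu.abs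
  refine le_ciSup (f := fun x : Icc a b => |u x|) ⟨K, ?_⟩ ⟨x, hx⟩
  rintro _ ⟨y, rfl⟩
  exact hK ⟨y, y.2, rfl⟩

theorem abs_iteratedDerivWithin_le_supNormIcc (hab : a < b) {f : ℝ → ℝ}
    (hf : ContDiffOn ℝ m f (Icc a b)) {x : ℝ} (hx : x ∈ Icc a b) :
    |iteratedDerivWithin m f (Icc a b) x| ≤ supNormIcc a b (iteratedDerivWithin m f (Icc a b)) :=
  abs_le_supNormIcc (hf.continuousOn_iteratedDerivWithin le_rfl (uniqueDiffOn_Icc hab)) hx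

/-- Jackson's inequality for splines: knots for which interpolation at the equidistant nodes is well
defined are spread out evenly enough for the quasi-interpolant to be of order `n ^ (-m)`. -/
theorem IsClampedKnots.exists_mem_splineSpace_norm_sub_le (h : IsClampedKnots a b m n τ)
    (hab : a < b) (hm : 1 ≤ m) (hn : 1 ≤ n) (hI : InterpolationWellDefined hab.le m n τ)
    {f : ℝ → ℝ} (hf : ContDiffOn ℝ m f (Icc a b)) :
    ∃ s ∈ splineSpace a b m n τ, ‖toContIcc f hf.continuousOn - s‖ ≤
      ((2 * m + 2) * (b - a)) ^ m / (m - 1).factorial * (n : ℝ) ^ (-(m : ℤ))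
        * supNormIcc a b (iteratedDerivWithin m f (Icc a b)) := by
  have hnodes := strictMono_equiNode hab hn
  have hsupp : ∀ j ≤ n, τ (j + m + 1) - τ j ≤ (2 * m + 2) * ((b - a) / n) := fun j =>
    h.knots_sub_le hab.le hn (h.mem_Icc_of_det_collocationMatrix_ne_zero
      ((Subtype.mono_coe _).comp hnodes.monotone)
      ((Matrix.isUnit_iff_isUnit_det _).mp (hI.isUnit_collocationMatrix hnodes.injective)).ne_zero)
  obtain ⟨s, hs⟩ := hI.exists_eq_sum_coxDeBoor hnodes.injective
    fun j => quasiCoeff m (Icc a b) f τ j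
  refine ⟨s, ⟨_, hs⟩, ?_⟩
  set M := supNormIcc a b (iteratedDerivWithin m f (Icc a b))
  have hM : ∀ x ∈ Icc a b, |iteratedDerivWithin m f (Icc a b) x| ≤ M := fun x hx =>
    abs_iteratedDerivWithin_le_supNormIcc hab hf hx
  have hM0 : 0 ≤ M := (abs_nonneg _).trans (hM a (left_mem_Icc.mpr hab.le))
  have : 0 < b - a := sub_pos.mpr hab
  rw [ContinuousMap.norm_le _ (by positivity)]
  intro x
  have hx := h.abs_sub_sum_quasiCoeff_le hab hm hf hsupp hM x.2
  rw [Finset.sum_range, ← hs x] at hx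
  refine hx.trans_eq ?_
  rw [zpow_neg, zpow_natCast, ← mul_div_assoc, div_pow]
  ring

end Interpolation

section PiecewiseLinear

theorem abs_sub_add_le_of_strongConvexOn_of_strongConcaveOn {E : Type*} [NormedAddCommGroup E]
    [NormedSpace ℝ E] {s : Set E} {f : E → ℝ} {M : ℝ} (hconv : StrongConvexOn s (-M) f)
    (hconc : StrongConcaveOn s (-M) f) (hM : 0 ≤ M) {x y : E} (hx : x ∈ s) (hy : y ∈ s)
    {α β : ℝ} (hα : 0 ≤ α) (hβ : 0 ≤ β) (hαβ : α + β = 1) :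
    |f (α • x + β • y) - (α * f x + β * f y)| ≤ M / 8 * ‖x - y‖ ^ 2 := by
  have hle := hconv.2 hx hy hα hβ hαβ
  have hge := hconc.2 hx hy hα hβ hαβ
  have hweights : α * β * (M / 2 * ‖x - y‖ ^ 2) ≤ M / 8 * ‖x - y‖ ^ 2 := by
    have : α * β ≤ 1 / 4 := by nlinarith [sq_nonneg (α - β)]
    calc α * β * (M / 2 * ‖x - y‖ ^ 2) ≤ 1 / 4 * (M / 2 * ‖x - y‖ ^ 2) := by gcongr
      _ = M / 8 * ‖x - y‖ ^ 2 := by ring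
  simp only [smul_eq_mul, neg_div, neg_mul, mul_neg] at hle hge
  rw [abs_le]
  constructor <;> linarith

theorem strongConvexOn_of_hasDerivWithinAt2_ge {s : Set ℝ} (hs : Convex ℝ s) {f f' f'' : ℝ → ℝ}
    {μ : ℝ} (hf : ∀ x ∈ s, HasDerivWithinAt f (f' x) s x)
    (hf' : ∀ x ∈ s, HasDerivWithinAt f' (f'' x) s x) (hμ : ∀ x ∈ s, μ ≤ f'' x) :
    StrongConvexOn s μ f := by
  rw [strongConvexOn_iff_convex]
  have hg (x) (hx : x ∈ s) :
      HasDerivWithinAt (fun x => f x - μ / 2 * ‖x‖ ^ 2) (f' x - μ * x) s x := by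
    simp only [Real.norm_eq_abs, sq_abs]
    refine ((hf x hx).sub (((hasDerivWithinAt_id x s).pow 2).const_mul (μ / 2))).congr_deriv ?_
    simp
    ring
  have hg' (x) (hx : x ∈ s) : HasDerivWithinAt (fun x => f' x - μ * x) (f'' x - μ) s x := by
    exact ((hf' x hx).sub ((hasDerivWithinAt_id x s).const_mul μ)).congr_deriv (by simp)
  exact convexOn_of_hasDerivWithinAt2_nonneg hs (fun x hx => (hg x hx).continuousWithinAt)
    (fun x hx => (hg x (interior_subset hx)).mono interior_subset)
    (fun x hx => (hg' x (interior_subset hx)).mono interior_subset)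
    fun x hx => sub_nonneg.mpr (hμ x (interior_subset hx))

theorem abs_sub_chord_le {s : Set ℝ} (hs : Convex ℝ s) {f f' f'' : ℝ → ℝ} {M u v t : ℝ}
    (hf : ∀ x ∈ s, HasDerivWithinAt f (f' x) s x)
    (hf' : ∀ x ∈ s, HasDerivWithinAt f' (f'' x) s x) (hM : ∀ x ∈ s, |f'' x| ≤ M)
    (hu : u ∈ s) (hv : v ∈ s) (huv : u < v) (ht : t ∈ Icc u v) :
    |f t - (f u + (f v - f u) / (v - u) * (t - u))| ≤ M / 8 * (v - u) ^ 2 := by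
  have hvu : 0 < v - u := sub_pos.mpr huv
  have hconv : StrongConvexOn s (-M) f :=
    strongConvexOn_of_hasDerivWithinAt2_ge hs hf hf' fun x hx => neg_le_of_abs_le (hM x hx)
  have hconc : StrongConcaveOn s (-M) f := by
    have hneg : StrongConvexOn s (-M) (-f) :=
      strongConvexOn_of_hasDerivWithinAt2_ge hs (fun x hx => (hf x hx).neg)
        (fun x hx => (hf' x hx).neg) fun x hx => neg_le_neg (le_of_abs_le (hM x hx))
    exact neg_neg f ▸ UniformConvexOn.neg hneg
  set α : ℝ := (v - t) / (v - u) with hα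
  set β : ℝ := (t - u) / (v - u) with hβ
  have hpoint : α • u + β • v = t := by
    rw [hα, hβ, smul_eq_mul, smul_eq_mul]
    field_simp
    ring
  have hvalue : α * f u + β * f v = f u + (f v - f u) / (v - u) * (t - u) := by
    rw [hα, hβ]
    field_simp
    ring
  have hcomb := abs_sub_add_le_of_strongConvexOn_of_strongConcaveOn hconv hconc
    ((abs_nonneg _).trans (hM u hu)) hu hv (div_nonneg (sub_nonneg.mpr ht.2) hvu.le)
    (div_nonneg (sub_nonneg.mpr ht.1) hvu.le) (by field_simp; ring)
  rwa [hpoint, hvalue, norm_sub_rev, Real.norm_eq_abs, sq_abs] at hcomb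

theorem exists_piecewiseLinear_eq_chord {a b t : ℝ} (hab : a < b) {n : ℕ} (hn : 1 ≤ n)
    (f : ℝ → ℝ) (ht : t ∈ Icc a b) :
    ∃ u ∈ Icc a b, ∃ v ∈ Icc a b, v - u = (b - a) / n ∧ t ∈ Icc u v ∧
      piecewiseLinear a b n f t = f u + (f v - f u) / (v - u) * (t - u) := by
  set d : ℝ := (b - a) / n
  have hd0 : 0 < d := div_pos (sub_pos.mpr hab) (by positivity)
  have hnd : n * d = b - a := mul_div_cancel₀ _ (by positivity)
  set i : ℕ := min ⌊(t - a) / d⌋₊ (n - 1) with hi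
  have hin : (i : ℝ) + 1 ≤ n := by
    exact_mod_cast (by omega : i + 1 ≤ n)
  have hut : a + i * d ≤ t := by
    have : (i : ℝ) ≤ (t - a) / d := (Nat.cast_le.mpr (min_le_left _ _)).trans
      (Nat.floor_le (div_nonneg (sub_nonneg.mpr ht.1) hd0.le))
    rw [le_div_iff₀ hd0] at this
    linarith
  have htv : t ≤ a + (i + 1) * d := by
    rcases min_choice ⌊(t - a) / d⌋₊ (n - 1) with hfloor | hlast
    · have := (Nat.lt_floor_add_one ((t - a) / d)).le
      rw [← hfloor, ← hi, div_le_iff₀ hd0] at this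
      linarith
    · have : (i : ℝ) + 1 = n := by exact_mod_cast (by omega : i + 1 = n)
      rw [this, hnd]
      linarith [ht.2]
  have hvb : a + (i + 1) * d ≤ b := by
    have : (i + 1) * d ≤ n * d := by gcongr
    linarith
  have hau : a ≤ a + i * d := le_add_of_nonneg_right (by positivity)
  exact ⟨a + i * d, ⟨hau, hut.trans ht.2⟩, a + (i + 1) * d, ⟨ht.1.trans htv, hvb⟩, by ring,
    ⟨hut, htv⟩, rfl⟩

theorem abs_sub_piecewiseLinear_le {a b t : ℝ} (hab : a < b) {n : ℕ} (hn : 1 ≤ n) {f : ℝ → ℝ}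
    (hf : ContDiffOn ℝ 2 f (Icc a b)) (ht : t ∈ Icc a b) :
    |f t - piecewiseLinear a b n f t|
      ≤ (b - a) ^ 2 / 8 * supNormIcc a b (iteratedDerivWithin 2 f (Icc a b))
        * (n : ℝ) ^ (-2 : ℤ) := by
  obtain ⟨u, hu, v, hv, huv, htuv, hchord⟩ := exists_piecewiseLinear_eq_chord hab hn f ht
  have hlt : u < v := sub_pos.mp (huv ▸ div_pos (sub_pos.mpr hab) (by positivity))
  have hf1 (x) (hx : x ∈ Icc a b) :=
    hasDerivWithinAt_iteratedDerivWithin (uniqueDiffOn_Icc hab) hf zero_lt_two hx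
  have hf2 (x) (hx : x ∈ Icc a b) :=
    hasDerivWithinAt_iteratedDerivWithin (uniqueDiffOn_Icc hab) hf one_lt_two hx
  rw [iteratedDerivWithin_zero] at hf1
  rw [hchord]
  refine (abs_sub_chord_le (convex_Icc a b) hf1 hf2
    (fun x hx => abs_iteratedDerivWithin_le_supNormIcc hab hf hx) hu hv hlt htuv).trans_eq ?_
  rw [huv, div_pow, zpow_neg, zpow_ofNat]
  ring

end PiecewiseLinear

theorem theorem4p1 (a b : ℝ) (hab : a < b) (m : ℕ) (hm : 1 ≤ m) :
    (∃ C : ℝ, 0 < C ∧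
      ∀ (n : ℕ), 1 ≤ n → ∀ (τ : ℕ → ℝ), IsClampedKnots a b m n τ →
      ∀ (hI : InterpolationWellDefined hab.le m n τ), BddAbove (interpolationRatios hI) →
      ∀ (f : ℝ → ℝ) (hf : ContDiffOn ℝ m f (Icc a b)),
        ‖toContIcc f hf.continuousOn - splineInterpolation hI (toContIcc f hf.continuousOn)‖
          ≤ (1 + interpolationNorm hI) * C * (n : ℝ) ^ (-(m : ℤ))
            * supNormIcc a b (iteratedDerivWithin m f (Icc a b))) ∧
    (∀ (n : ℕ), 1 ≤ n → ∀ (f : ℝ → ℝ), ContDiffOn ℝ 2 f (Icc a b) →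
      ∀ t ∈ Icc a b,
        |f t - piecewiseLinear a b n f t|
          ≤ (b - a) ^ 2 / 8 * supNormIcc a b (iteratedDerivWithin 2 f (Icc a b))
            * (n : ℝ) ^ (-2 : ℤ)) := by
  have : 0 < b - a := sub_pos.mpr hab
  refine ⟨⟨((2 * m + 2) * (b - a)) ^ m / (m - 1).factorial, by positivity, ?_⟩,
    fun n hn f hf t ht => abs_sub_piecewiseLinear_le hab hn hf ht⟩
  intro n hn τ hτ hI hB f hf
  obtain ⟨s, hs, hsf⟩ := hτ.exists_mem_splineSpace_norm_sub_le hab hm hn hI hf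
  rw [mul_assoc (1 + _), mul_assoc (1 + _)]
  exact (norm_sub_splineInterpolation_le hI hB _ hs).trans
    (mul_le_mul_of_nonneg_left hsf (add_nonneg zero_le_one (interpolationNorm_nonneg hI)))
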